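/- Theorem. For a natural number $n$ and $q\in[0,1]$ let $G_{n,q}$ be the binomial random graph on $n$ labelled vertices, in which each of the $\binom n2$ possible edges is present independently with probability $q$. A circuit is a connected $2$-regular graph; a Hamilton circuit of a graph $G$ is a circuit that is a spanning subgraph of $G$; a cycle of $G$ is an element of the cycle space $\mathrm{Z}_1(G;\mathbb{F}_2)$, i.e. a set of edges of $G$ that meets every vertex in an even number of edges. Let $p\colon\mathbb{N}\to[0,1]$ be such that, as $n\to\infty$ through the odd numbers, the probability that $G\sim G_{n,p(n)}$ satisfies both (1) $G$ is neither a forest nor a circuit, and (2) every cycle of $G$ is a symmetric difference of Hamilton circuits of $G$, i.e. $\mathrm{Z}_1(G;\mathbb{F}_2)$ is the $\mathbb{F}_2$-span of the Hamilton circuits of $G$, tends to $1$. Then for every real $c>0$, $$p(n) > \frac{\log n + 2\log\log n + c}{n}\qquad\text{for all sufficiently large odd } n.$$ -/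

import Mathlib

open Filter Topology

namespace SimpleGraph

/-- A graph is a circuit if it is connected and 2-regular. -/
def IsCircuitGraph {V : Type*} (G : SimpleGraph V) : Prop :=
  G.Connected ∧ ∀ v : V, (G.neighborSet v).ncard = 2

/-- `H` is (as a spanning subgraph) a Hamilton circuit of `G`. -/
def IsHamiltonCircuitOf {V : Type*} (H G : SimpleGraph V) : Prop :=
  H ≤ G ∧ H.IsCircuitGraph

/-- The edge space of `G` over the two-element field: the vectors indexed by unordered pairs of
vertices that vanish at all pairs which are not edges of `G`. -/
def edgeSpaceF2 {V : Type*} (G : SimpleGraph V) : Submodule (ZMod 2) (Sym2 V → ZMod 2) where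
  carrier := {z | ∀ e, e ∉ G.edgeSet → z e = 0}
  add_mem' := by
    intro a b ha hb e he
    simp [ha e he, hb e he]
  zero_mem' := by
    intro e _
    rfl
  smul_mem' := by
    intro c a ha e he
    simp [ha e he]

/-- The vector of the edge set of `H` with respect to the standard basis of the edge space. -/
noncomputable def edgeVectorF2 {V : Type*} (H : SimpleGraph V) : Sym2 V → ZMod 2 :=
  H.edgeSet.indicator 1

open scoped Classical in
/-- The cycle space `Z_1(G; F_2)` of a finite graph: the kernel of the incidence matrix of `G`
modulo 2 on the edge space of `G`. -/
noncomputable def cycleSpaceF2 {V : Type*} [Fintype V] (G : SimpleGraph V) :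
    Submodule (ZMod 2) (Sym2 V → ZMod 2) :=
  G.edgeSpaceF2 ⊓ LinearMap.ker (Matrix.mulVecLin (G.incMatrix (ZMod 2)))

/-- The span over the two-element field of the Hamilton circuits of `G`. Addition of edge vectors
modulo 2 is the symmetric difference of edge sets. -/
noncomputable def hamiltonSpanF2 {V : Type*} (G : SimpleGraph V) :
    Submodule (ZMod 2) (Sym2 V → ZMod 2) :=
  Submodule.span (ZMod 2) (edgeVectorF2 '' {H : SimpleGraph V | H.IsHamiltonCircuitOf G})

/-- Every element of the cycle space of `G` is a symmetric difference of Hamilton circuits. -/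
def HasHamiltonGeneratedCycleSpace {V : Type*} [Fintype V] (G : SimpleGraph V) : Prop :=
  G.cycleSpaceF2 = G.hamiltonSpanF2

end SimpleGraph

/-! Suppose the cycle space is nontrivial and generated by Hamilton circuits, the order is odd, and
`v` has degree at most two. Every Hamilton circuit then contains a fixed edge `e` at `v` and has
oddly many edges, so the linear functional `∑ f, z f - z e` kills the Hamilton span. A closed walk
avoiding `v` has coordinate `0` at `e`, hence even length, so `G - v` is bipartite
(`colorable_two_induce_compl`) and half of its vertices are independent. For `log n / n ≤ p`, so
large an independent set has probability at most `exp (-n)`. If also `p ≤ (log n + 2 log log n + c)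
/ n`, the expected number of vertices of degree at most two is bounded below, and the second moment
method (`measureReal_iInter_compl_le`) yields such a vertex with probability bounded away from zero.
For `p ≤ log n / n` the same method yields an isolated vertex, which excludes Hamilton circuits. -/

namespace SimpleGraph

/-! ### Cycle space, parity and vertices of degree at most two. -/

variable {V : Type*}

open scoped Classical in
/-- The vector over the two-element field counting how often a walk uses each edge. -/
noncomputable def Walk.edgeVectorF2 {G : SimpleGraph V} {u v : V} (w : G.Walk u v) :
    Sym2 V → ZMod 2 :=
  (w.edges.map fun e => Pi.single e 1).sum

open scoped Classical in
theorem Walk.edgeVectorF2_cons {G : SimpleGraph V} {u v x : V} (h : G.Adj u v) (w : G.Walk v x) :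
    (Walk.cons h w).edgeVectorF2 = Pi.single s(u, v) 1 + w.edgeVectorF2 := by
  simp [Walk.edgeVectorF2]

open scoped Classical in
theorem Walk.edgeVectorF2_apply {G : SimpleGraph V} {u v : V} (w : G.Walk u v) (e : Sym2 V) :
    w.edgeVectorF2 e = (w.edges.count e : ℕ) := by
  induction w with
  | nil => simp [Walk.edgeVectorF2]
  | @cons a b _ h w ih =>
    rw [Walk.edgeVectorF2_cons, Pi.add_apply, ih, Walk.edges_cons, List.count_cons]
    rw [Pi.single_apply, Nat.cast_add, add_comm]
    by_cases he : e = s(a, b)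
    · subst he; simp
    · simp [he, Ne.symm he]

theorem Walk.edgeVectorF2_mem_edgeSpaceF2 {G : SimpleGraph V} {u v : V} (w : G.Walk u v) :
    w.edgeVectorF2 ∈ G.edgeSpaceF2 := by
  classical
  intro e he
  rw [Walk.edgeVectorF2_apply, List.count_eq_zero_of_not_mem, Nat.cast_zero]
  exact fun h => he (w.edges_subset_edgeSet h)

variable [Fintype V]

theorem Walk.sum_edgeVectorF2 {G : SimpleGraph V} {u v : V} (w : G.Walk u v) :
    ∑ e, w.edgeVectorF2 e = (w.length : ZMod 2) := by
  classical
  induction w with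
  | nil => simp [Walk.edgeVectorF2]
  | cons h w ih =>
    simp_rw [Walk.edgeVectorF2_cons, Pi.add_apply]
    rw [Finset.sum_add_distrib, ih]
    simp [add_comm]

-- Each passage through a vertex uses two incidences, which cancel mod 2; only the ends survive, and
-- for a closed walk they cancel too.
open scoped Classical in
theorem Walk.incMatrix_mulVec_edgeVectorF2 {G : SimpleGraph V} {u v : V} (w : G.Walk u v) :
    (G.incMatrix (ZMod 2)).mulVec w.edgeVectorF2 = Pi.single u 1 + Pi.single v 1 := by
  induction w with
  | nil => simp [Walk.edgeVectorF2, ZModModule.add_self]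
  | @cons a b c h w ih =>
    rw [Walk.edgeVectorF2_cons, Matrix.mulVec_add, ih]
    have : (G.incMatrix (ZMod 2)).mulVec (Pi.single s(a, b) 1) = Pi.single a 1 + Pi.single b 1 := by
      ext x
      have hne := h.ne
      rw [Matrix.mulVec_single_one]
      simp only [Matrix.col_apply, incMatrix_apply', mk'_mem_incidenceSet_iff, h, true_and,
        Pi.add_apply, Pi.single_apply]
      by_cases hxa : x = a <;> by_cases hxb : x = b <;> simp_all
    rw [this, add_assoc, ← add_assoc (Pi.single b 1), ZModModule.add_self, zero_add]

theorem Walk.edgeVectorF2_mem_cycleSpaceF2 {G : SimpleGraph V} {u : V} (w : G.Walk u u) :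
    w.edgeVectorF2 ∈ G.cycleSpaceF2 := by
  classical
  refine ⟨w.edgeVectorF2_mem_edgeSpaceF2, ?_⟩
  rw [SetLike.mem_coe, LinearMap.mem_ker, Matrix.mulVecLin_apply,
    Walk.incMatrix_mulVec_edgeVectorF2, ZModModule.add_self]

/-- If the cycle space of a graph with a cycle is generated by Hamilton circuits, then there is a
Hamilton circuit. -/
theorem HasHamiltonGeneratedCycleSpace.exists_isHamiltonCircuitOf {G : SimpleGraph V}
    (hG : G.HasHamiltonGeneratedCycleSpace) (hc : ¬ G.IsAcyclic) :
    ∃ H : SimpleGraph V, H.IsHamiltonCircuitOf G := by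
  classical
  by_contra! hno
  have hbot : G.cycleSpaceF2 = ⊥ := by
    rw [hG, hamiltonSpanF2, Submodule.span_eq_bot]
    rintro _ ⟨H, hH, -⟩
    exact absurd hH (hno H)
  simp only [IsAcyclic, not_forall, not_not] at hc
  obtain ⟨u, w, hw⟩ := hc
  have h0 := w.edgeVectorF2_mem_cycleSpaceF2
  rw [hbot, Submodule.mem_bot] at h0
  cases w with
  | nil => exact hw.ne_nil rfl
  | @cons _ b _ h w =>
    -- A cycle repeats no edge, so its vector has coordinate `1` at its first edge.
    have h1 := congrFun h0 s(u, b)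
    rw [Walk.edgeVectorF2_apply, List.count_eq_one_of_mem hw.edges_nodup (by simp)] at h1
    simp at h1

theorem IsCircuitGraph.ncard_edgeSet {H : SimpleGraph V} (hH : H.IsCircuitGraph) :
    H.edgeSet.ncard = Fintype.card V := by
  classical
  have h := H.sum_degrees_eq_twice_card_edges
  have hd : ∀ v, H.degree v = 2 := fun v => by
    rw [← hH.2 v, ← card_neighborSet_eq_degree, Set.ncard_eq_toFinset_card', Set.toFinset_card]
  simp only [hd, Finset.sum_const, Finset.card_univ, smul_eq_mul] at h
  rw [← coe_edgeFinset, Set.ncard_coe_finset]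
  omega

theorem IsCircuitGraph.sum_edgeVectorF2 {H : SimpleGraph V} (hH : H.IsCircuitGraph) :
    ∑ e, H.edgeVectorF2 e = (Fintype.card V : ZMod 2) := by
  classical
  rw [← hH.ncard_edgeSet, edgeVectorF2, ← coe_edgeFinset, Set.ncard_coe_finset]
  simp only [Set.indicator_apply, Pi.one_apply, Finset.sum_boole]
  congr 2
  ext e
  simp

/-- If every Hamilton circuit of a graph of odd order uses the edge `e`, then in the span of the
Hamilton circuits the parity of the number of edges is the coordinate at `e`. -/
theorem sum_eq_apply_of_mem_hamiltonSpanF2 {G : SimpleGraph V} (hodd : Odd (Fintype.card V))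
    {e : Sym2 V} (he : ∀ H : SimpleGraph V, H.IsHamiltonCircuitOf G → e ∈ H.edgeSet)
    {z : Sym2 V → ZMod 2} (hz : z ∈ G.hamiltonSpanF2) : ∑ f, z f = z e := by
  induction hz using Submodule.span_induction with
  | mem z hz =>
    obtain ⟨H, hH, rfl⟩ := hz
    rw [hH.2.sum_edgeVectorF2, (ZMod.natCast_eq_one_iff_odd).2 hodd, edgeVectorF2,
      Set.indicator_of_mem (he H hH), Pi.one_apply]
  | zero => simp
  | add x y _ _ hx hy => simp [Finset.sum_add_distrib, hx, hy]
  | smul a x _ hx => simp [← Finset.mul_sum, hx]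

/-- A Hamilton circuit needs two edges at `v`, and no others are available; thus the edges at `v`
lie in every Hamilton circuit. -/
theorem IsHamiltonCircuitOf.neighborSet_eq {H G : SimpleGraph V} (hH : H.IsHamiltonCircuitOf G)
    {v : V} (hv : (G.neighborSet v).ncard ≤ 2) : H.neighborSet v = G.neighborSet v :=
  Set.eq_of_subset_of_ncard_le (fun _ h => hH.1 h) (by rw [hH.2.2 v]; exact hv) (Set.toFinite _)

/-- Deleting a vertex of degree at most two from a graph of odd order whose cycle space is
nontrivial and generated by Hamilton circuits leaves a bipartite graph. -/
theorem HasHamiltonGeneratedCycleSpace.colorable_two_induce_compl {G : SimpleGraph V}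
    (hG : G.HasHamiltonGeneratedCycleSpace) (hc : ¬ G.IsAcyclic) (hodd : Odd (Fintype.card V))
    {v : V} (hv : (G.neighborSet v).ncard ≤ 2) : (G.induce {v}ᶜ).Colorable 2 := by
  classical
  obtain ⟨H₀, hH₀⟩ := hG.exists_isHamiltonCircuitOf hc
  obtain ⟨a, ha⟩ : (H₀.neighborSet v).Nonempty := by
    rw [← Set.ncard_pos (Set.toFinite _), hH₀.2.2 v]; norm_num
  rw [hH₀.neighborSet_eq hv] at ha
  rw [two_colorable_iff_forall_loop_even]
  intro u w
  let w' := w.map (Embedding.induce {v}ᶜ).toHom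
  have hw' : w'.edgeVectorF2 ∈ G.hamiltonSpanF2 := by
    have := w'.edgeVectorF2_mem_cycleSpaceF2
    rwa [hG] at this
  -- The left side becomes the length of `w'` mod 2, the right side `0` because `w'` avoids `v`.
  have key := sum_eq_apply_of_mem_hamiltonSpanF2 hodd (e := s(v, a)) (fun H hH => by
    have : a ∈ H.neighborSet v := by rw [hH.neighborSet_eq hv]; exact ha
    exact this) hw'
  rw [Walk.sum_edgeVectorF2, Walk.edgeVectorF2_apply, List.count_eq_zero_of_not_mem,
    Nat.cast_zero, ZMod.natCast_eq_zero_iff_even, Walk.length_map] at key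
  · exact key
  · intro hmem
    have hvs := Walk.fst_mem_support_of_mem_edges _ hmem
    rw [Walk.support_map, List.mem_map] at hvs
    obtain ⟨x, -, hx⟩ := hvs
    exact x.2 hx

/-- A graph that becomes bipartite on deleting one vertex has a large independent set. -/
theorem exists_isIndepSet_of_colorable_two_induce_compl {G : SimpleGraph V} {v : V}
    (h : (G.induce {v}ᶜ).Colorable 2) {m : ℕ} (hm : Fintype.card V = 2 * m + 1) :
    ∃ s : Finset V, s.card = m ∧ G.IsIndepSet (s : Set V) := by
  classical
  obtain ⟨C⟩ := h
  have hcard : Fintype.card (({v}ᶜ : Set V)) = 2 * m := by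
    rw [Fintype.card_compl_set]; simp [hm]
  have hsum := Finset.card_eq_sum_card_fiberwise (f := C) (s := Finset.univ) (t := Finset.univ)
    (fun _ _ => Finset.mem_coe.2 (Finset.mem_univ _))
  rw [Finset.card_univ, hcard, Fin.sum_univ_two] at hsum
  obtain ⟨i, hi⟩ : ∃ i : Fin 2, m ≤ (Finset.univ.filter fun x => C x = i).card := by
    by_contra! hlt
    have h0 := hlt 0
    have h1 := hlt 1
    omega
  obtain ⟨t, ht, htm⟩ := Finset.exists_subset_card_eq hi
  refine ⟨t.map (Function.Embedding.subtype _), by simpa using htm, ?_⟩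
  intro x hx y hy _ hxy
  simp only [Finset.coe_map, Set.mem_image, Finset.mem_coe] at hx hy
  obtain ⟨x, hx, rfl⟩ := hx
  obtain ⟨y, hy, rfl⟩ := hy
  refine C.valid (show (G.induce {v}ᶜ).Adj x y from hxy) ?_
  rw [(Finset.mem_filter.1 (ht hx)).2, (Finset.mem_filter.1 (ht hy)).2]

end SimpleGraph

/-! ### The second moment bound. -/

open MeasureTheory ProbabilityTheory
open unitInterval (toNNReal)

/-- Second moment bound: a family of events that are pairwise positively correlated by a factor of
at most two, and whose probabilities add up to at least `x`, misses with probability at most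
`1 - x / (1 + 2 * x)`. -/
theorem measureReal_iInter_compl_le {Ω ι : Type*} [MeasurableSpace Ω] [Fintype ι]
    (P : Measure Ω) [IsProbabilityMeasure P] {A : ι → Set Ω} (hA : ∀ i, MeasurableSet (A i))
    (hpair : ∀ i j, i ≠ j → P.real (A i ∩ A j) ≤ 2 * (P.real (A i) * P.real (A j)))
    {x : ℝ} (hx : 0 ≤ x) (hsum : x ≤ ∑ i, P.real (A i)) :
    P.real (⋂ i, (A i)ᶜ) ≤ 1 - x / (1 + 2 * x) := by
  classical
  set M := ∑ i, P.real (A i) with hM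
  -- This `t` minimises `1 - 2 * t * M + t ^ 2 * (M + 2 * M ^ 2)`, which bounds the expectation of
  -- `(1 - t * N) ^ 2`, where `N` counts the events that occur. That square dominates the indicator
  -- of `N = 0`.
  set t : ℝ := 1 / (1 + 2 * M) with ht
  have hM0 : 0 ≤ M := hx.trans hsum
  have hind : ∀ B : Set Ω, MeasurableSet B → Integrable (B.indicator (1 : Ω → ℝ)) P := fun B hB =>
    (integrable_const (1 : ℝ)).indicator hB
  have hpt : ∀ ω, (⋂ i, (A i)ᶜ).indicator (1 : Ω → ℝ) ω ≤
      1 - 2 * t * ∑ i, (A i).indicator (1 : Ω → ℝ) ω +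
        t ^ 2 * ∑ i, ∑ j, (A i ∩ A j).indicator (1 : Ω → ℝ) ω := by
    intro ω
    have hsq : ∑ i, ∑ j, (A i ∩ A j).indicator (1 : Ω → ℝ) ω =
        (∑ i, (A i).indicator (1 : Ω → ℝ) ω) ^ 2 := by
      rw [sq, Finset.sum_mul_sum]
      refine Finset.sum_congr rfl fun i _ => Finset.sum_congr rfl fun j _ => ?_
      rw [Set.inter_indicator_one, Pi.mul_apply]
    rw [hsq]
    by_cases hω : ω ∈ ⋂ i, (A i)ᶜ
    · have h0 : ∑ i, (A i).indicator (1 : Ω → ℝ) ω = 0 :=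
        Finset.sum_eq_zero fun i _ => Set.indicator_of_notMem (Set.mem_iInter.1 hω i) _
      rw [Set.indicator_of_mem hω, h0]
      simp
    · rw [Set.indicator_of_notMem hω]
      nlinarith [sq_nonneg (1 - t * ∑ i, (A i).indicator (1 : Ω → ℝ) ω)]
  have hmeas : MeasurableSet (⋂ i, (A i)ᶜ) := MeasurableSet.iInter fun i => (hA i).compl
  have hi1 : Integrable (fun ω => ∑ i, (A i).indicator (1 : Ω → ℝ) ω) P :=
    integrable_finsetSum _ fun i _ => hind _ (hA i)
  have hi2 : Integrable (fun ω => ∑ i, ∑ j, (A i ∩ A j).indicator (1 : Ω → ℝ) ω) P :=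
    integrable_finsetSum _ fun i _ => integrable_finsetSum _ fun j _ =>
      hind _ ((hA i).inter (hA j))
  have hint := integral_mono (hind _ hmeas)
    (((integrable_const (1 : ℝ)).sub (hi1.const_mul (2 * t))).add (hi2.const_mul (t ^ 2))) hpt
  have he1 : ∫ ω, ∑ i, (A i).indicator (1 : Ω → ℝ) ω ∂P = M := by
    rw [integral_finsetSum _ fun i _ => hind _ (hA i)]
    exact Finset.sum_congr rfl fun i _ => integral_indicator_one (hA i)
  have he2 : ∫ ω, ∑ i, ∑ j, (A i ∩ A j).indicator (1 : Ω → ℝ) ω ∂P =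
      ∑ i, ∑ j, P.real (A i ∩ A j) := by
    rw [integral_finsetSum _ fun i _ => integrable_finsetSum _ fun j _ =>
      hind _ ((hA i).inter (hA j))]
    refine Finset.sum_congr rfl fun i _ => ?_
    rw [integral_finsetSum _ fun j _ => hind _ ((hA i).inter (hA j))]
    exact Finset.sum_congr rfl fun j _ => integral_indicator_one ((hA i).inter (hA j))
  have hrhs : ∫ ω, (1 - 2 * t * ∑ i, (A i).indicator (1 : Ω → ℝ) ω +
        t ^ 2 * ∑ i, ∑ j, (A i ∩ A j).indicator (1 : Ω → ℝ) ω) ∂P =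
      1 - 2 * t * M + t ^ 2 * ∑ i, ∑ j, P.real (A i ∩ A j) := by
    have hi3 : Integrable (fun ω => 1 - 2 * t * ∑ i, (A i).indicator (1 : Ω → ℝ) ω) P :=
      (integrable_const (1 : ℝ)).sub (hi1.const_mul (2 * t))
    rw [integral_add hi3 (hi2.const_mul (t ^ 2)), integral_sub (integrable_const (1 : ℝ)) (hi1.const_mul (2 * t)),
      integral_const_mul, integral_const_mul, he1, he2]
    simp
  have hdouble : ∑ i, ∑ j, P.real (A i ∩ A j) ≤ M + 2 * M ^ 2 := by
    calc ∑ i, ∑ j, P.real (A i ∩ A j)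
        ≤ ∑ i, ∑ j, ((if i = j then P.real (A i) else 0) + 2 * (P.real (A i) * P.real (A j))) := by
          refine Finset.sum_le_sum fun i _ => Finset.sum_le_sum fun j _ => ?_
          by_cases hij : i = j
          · subst hij
            simp only [Set.inter_self, if_true]
            nlinarith [sq_nonneg (P.real (A i))]
          · simpa [hij] using hpair i j hij
      _ = M + 2 * M ^ 2 := by
          simp only [Finset.sum_add_distrib, Finset.sum_ite_eq, Finset.mem_univ, if_true,
            ← Finset.mul_sum]
          rw [sq, hM, Finset.sum_mul_sum]
          simp only [Finset.mul_sum]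
  have hint' : P.real (⋂ i, (A i)ᶜ) ≤ 1 - 2 * t * M + t ^ 2 * (M + 2 * M ^ 2) := by
    calc P.real (⋂ i, (A i)ᶜ) = ∫ ω, (⋂ i, (A i)ᶜ).indicator (1 : Ω → ℝ) ω ∂P :=
          (integral_indicator_one hmeas).symm
      _ ≤ _ := hint
      _ = _ := hrhs
      _ ≤ _ := by gcongr
  have ht' : 1 - 2 * t * M + t ^ 2 * (M + 2 * M ^ 2) = 1 - M / (1 + 2 * M) := by
    rw [ht]; field_simp; ring
  have hmono : x / (1 + 2 * x) ≤ M / (1 + 2 * M) := by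
    rw [div_le_div_iff₀ (by positivity) (by positivity)]
    nlinarith
  linarith

/-! ### Independence of edges in the binomial random graph. -/

namespace SimpleGraph

theorem measurable_mem_edgeSet {V : Type*} (e : Sym2 V) :
    Measurable fun G : SimpleGraph V => e ∈ G.edgeSet := by
  have := measurable_edgeSet (V := V)
  fun_prop

/-- Every set of graphs on a finite vertex set is measurable. -/
theorem measurableSet_of_finite {V : Type*} [Finite V] (A : Set (SimpleGraph V)) :
    MeasurableSet A :=
  measurableEmbedding_edgeSet.measurableSet_image.1 (Set.toFinite _).measurableSet

variable {V : Type*} [Fintype V] (p : unitInterval)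

/-- The joint law of the edge indicators is a product, which is the source of independence. At a
diagonal pair both summands sit at `False`. -/
theorem map_mem_edgeSet_binomialRandom :
    (binomialRandom V p).map (fun G e => e ∈ G.edgeSet) = Measure.infinitePi
      fun e : Sym2 V => toNNReal p • .dirac (¬ e.IsDiag) + toNNReal (unitInterval.symm p) • .dirac False := by
  have h1 : (binomialRandom V p).map edgeSet = setBernoulli (Sym2.diagSetᶜ) p := by
    rw [binomialRandom, measurableEmbedding_edgeSet.map_comap]
    refine Measure.restrict_eq_self_of_ae_mem ?_
    -- Almost every sample avoids the diagonal and so is an edge set: pulling back to graphs loses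
    -- no mass.
    filter_upwards [setBernoulli_ae_subset] with s hs
    exact ⟨fromEdgeSet s, by
      simpa [← Set.compl_ofPred, Set.subset_compl_iff_disjoint_right] using hs⟩
  have h2 : Measurable (fun (s : Set (Sym2 V)) e => e ∈ s) := by fun_prop
  have h3 := Measure.map_map (μ := binomialRandom V p) h2 measurable_edgeSet
  rw [h1, setBernoulli_eq_map, Measure.map_map h2 (by fun_prop)] at h3
  have h4 : (fun (s : Set (Sym2 V)) e => e ∈ s) ∘ (fun q : Sym2 V → Prop => {i | q i}) = id := by
    ext; simp
  rw [h4, Measure.map_id] at h3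
  exact h3.symm

theorem map_mem_edgeSet_apply_binomialRandom (e : Sym2 V) :
    (binomialRandom V p).map (fun G => e ∈ G.edgeSet) =
      toNNReal p • .dirac (¬ e.IsDiag) + toNNReal (unitInterval.symm p) • .dirac False := by
  rw [← Measure.infinitePi_map_eval (fun e : Sym2 V => (toNNReal p • Measure.dirac (¬ e.IsDiag) +
      toNNReal (unitInterval.symm p) • Measure.dirac False : Measure Prop)) e,
    ← map_mem_edgeSet_binomialRandom, Measure.map_map (by fun_prop)
      (measurable_pi_iff.2 fun e => measurable_mem_edgeSet e)]
  rfl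

/-- The edges of a binomial random graph are independent. -/
theorem iIndepFun_mem_edgeSet_binomialRandom :
    iIndepFun (fun (e : Sym2 V) (G : SimpleGraph V) => e ∈ G.edgeSet) (binomialRandom V p) := by
  rw [iIndepFun_iff_map_fun_eq_infinitePi_map (fun e => measurable_mem_edgeSet e),
    map_mem_edgeSet_binomialRandom]
  simp_rw [map_mem_edgeSet_apply_binomialRandom]

variable {p} in
theorem binomialRandom_real_mem_edgeSet {e : Sym2 V} (he : ¬ e.IsDiag) :
    (binomialRandom V p).real ((fun G : SimpleGraph V => e ∈ G.edgeSet) ⁻¹' {True}) = p := by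
  rw [← map_measureReal_apply (measurable_mem_edgeSet e) .of_discrete,
    map_mem_edgeSet_apply_binomialRandom, measureReal_def]
  simp [he]

variable {p} in
theorem binomialRandom_real_notMem_edgeSet {e : Sym2 V} (he : ¬ e.IsDiag) :
    (binomialRandom V p).real ((fun G : SimpleGraph V => e ∈ G.edgeSet) ⁻¹' {False}) = 1 - p := by
  rw [← map_measureReal_apply (measurable_mem_edgeSet e) .of_discrete,
    map_mem_edgeSet_apply_binomialRandom, measureReal_def]
  simp [he]

/-- The probability that prescribed pairs are edges and other prescribed pairs are not. -/
theorem binomialRandom_real_cylinder {S T : Finset (Sym2 V)} (hST : Disjoint S T)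
    (hS : ∀ e ∈ S, ¬ e.IsDiag) (hT : ∀ e ∈ T, ¬ e.IsDiag) :
    (binomialRandom V p).real
      {G | (∀ e ∈ S, e ∈ G.edgeSet) ∧ ∀ e ∈ T, e ∉ G.edgeSet} =
        (p : ℝ) ^ S.card * (1 - p : ℝ) ^ T.card := by
  classical
  have h := (iIndepFun_mem_edgeSet_binomialRandom (V := V) p).measure_inter_preimage_eq_mul
    (S ∪ T) (sets := fun e => if e ∈ S then {True} else {False}) (fun _ _ => .of_discrete)
  have hset : {G : SimpleGraph V | (∀ e ∈ S, e ∈ G.edgeSet) ∧ ∀ e ∈ T, e ∉ G.edgeSet} =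
      ⋂ e ∈ S ∪ T, (fun G : SimpleGraph V => e ∈ G.edgeSet) ⁻¹'
        (if e ∈ S then {True} else {False}) := by
    ext G
    simp only [Set.mem_ofPred_eq, Set.mem_iInter, Finset.mem_union, Set.mem_preimage]
    constructor
    · rintro ⟨h1, h2⟩ e (he | he)
      · simp [he, h1 e he]
      · simp [Finset.disjoint_right.1 hST he, h2 e he]
    · intro h
      refine ⟨fun e he => ?_, fun e he => ?_⟩
      · simpa [he] using h e (Or.inl he)
      · simpa [Finset.disjoint_right.1 hST he] using h e (Or.inr he)
  rw [hset, measureReal_def, h, ENNReal.toReal_prod, Finset.prod_union hST]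
  congr 1
  · refine Finset.prod_eq_pow_card fun e he => ?_
    rw [if_pos he]
    exact binomialRandom_real_mem_edgeSet (hS e he)
  · refine Finset.prod_eq_pow_card fun e he => ?_
    rw [if_neg (Finset.disjoint_right.1 hST he)]
    exact binomialRandom_real_notMem_edgeSet (hT e he)

/-- Events that depend on disjoint sets of pairs are independent. -/
theorem binomialRandom_real_inter_eq_mul {S T : Finset (Sym2 V)} (hST : Disjoint S T)
    {A B : Set (SimpleGraph V)}
    (hA : ∀ G G' : SimpleGraph V, (∀ e ∈ S, (e ∈ G.edgeSet ↔ e ∈ G'.edgeSet)) → G ∈ A → G' ∈ A)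
    (hB : ∀ G G' : SimpleGraph V, (∀ e ∈ T, (e ∈ G.edgeSet ↔ e ∈ G'.edgeSet)) → G ∈ B → G' ∈ B) :
    (binomialRandom V p).real (A ∩ B) =
      (binomialRandom V p).real A * (binomialRandom V p).real B := by
  have h := (iIndepFun_mem_edgeSet_binomialRandom (V := V) p).indepFun_finset S T hST
    (fun e => measurable_mem_edgeSet e)
  -- An event determined by the pairs in `S` is the preimage of its image under restriction to `S`.
  have key : ∀ (S : Finset (Sym2 V)) (A : Set (SimpleGraph V)),
      (∀ G G' : SimpleGraph V, (∀ e ∈ S, (e ∈ G.edgeSet ↔ e ∈ G'.edgeSet)) → G ∈ A → G' ∈ A) →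
      A = (fun (G : SimpleGraph V) (e : S) => (e : Sym2 V) ∈ G.edgeSet) ⁻¹'
        ((fun (G : SimpleGraph V) (e : S) => (e : Sym2 V) ∈ G.edgeSet) '' A) := by
    intro S A hA
    refine (Set.subset_preimage_image _ _).antisymm ?_
    rintro G ⟨G', hG', heq⟩
    exact hA G' G (fun e he => iff_of_eq (congrFun heq ⟨e, he⟩)) hG'
  have h' := h.measure_inter_preimage_eq_mul
    ((fun (G : SimpleGraph V) (e : S) => (e : Sym2 V) ∈ G.edgeSet) '' A)
    ((fun (G : SimpleGraph V) (e : T) => (e : Sym2 V) ∈ G.edgeSet) '' B)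
    .of_discrete .of_discrete
  rw [← key S A hA, ← key T B hB] at h'
  rw [measureReal_def, h', ENNReal.toReal_mul, measureReal_def, measureReal_def]

/-! ### Small degrees and independent sets. -/

/-- The events that two given vertices have small degree are almost independent. -/
theorem binomialRandom_real_ncard_neighborSet_le_inter (k : ℕ) {u v : V} (huv : u ≠ v) :
    (1 - p : ℝ) ^ 2 * (binomialRandom V p).real
      ({G | (G.neighborSet u).ncard ≤ k} ∩ {G | (G.neighborSet v).ncard ≤ k}) ≤
    (binomialRandom V p).real {G | (G.neighborSet u).ncard ≤ k} *
      (binomialRandom V p).real {G | (G.neighborSet v).ncard ≤ k} := by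
  classical
  -- The degrees of `u` and `v` share only the pair `s(u, v)`. Ignoring it makes the events
  -- independent; requiring it to be a non-edge costs a factor `1 - p` per vertex.
  let B : V → V → Set (SimpleGraph V) := fun a b => {G | (G.neighborSet a \ {b}).ncard ≤ k}
  let S : V → V → Finset (Sym2 V) := fun a b => Finset.univ.filter fun e => a ∈ e ∧ b ∉ e
  have hB : ∀ a b, a ≠ b → ∀ G G' : SimpleGraph V,
      (∀ e ∈ S a b, (e ∈ G.edgeSet ↔ e ∈ G'.edgeSet)) → G ∈ B a b → G' ∈ B a b := by
    intro a b hab G G' h hG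
    have : G'.neighborSet a \ {b} = G.neighborSet a \ {b} := by
      ext w
      simp only [Set.mem_sdiff, mem_neighborSet, Set.mem_singleton_iff]
      refine and_congr_left fun hw => ?_
      exact (h s(a, w) (by simp [S, hab.symm, Ne.symm hw])).symm
    simpa only [B, Set.mem_ofPred_eq, this] using hG
  have hstep : ∀ a b, a ≠ b → (1 - p : ℝ) * (binomialRandom V p).real (B a b) ≤
      (binomialRandom V p).real {G | (G.neighborSet a).ncard ≤ k} := by
    intro a b hab
    have h1 := binomialRandom_real_cylinder p (S := ∅) (T := {s(a, b)}) (by simp) (by simp)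
      (by simpa using hab)
    have h2 := binomialRandom_real_inter_eq_mul p (S := {s(a, b)}) (T := S a b) (by simp [S])
      (A := {G | (∀ e ∈ (∅ : Finset (Sym2 V)), e ∈ G.edgeSet) ∧
        ∀ e ∈ ({s(a, b)} : Finset (Sym2 V)), e ∉ G.edgeSet}) (B := B a b)
      (fun G G' h hG => by
        have := h s(a, b) (by simp)
        simp_all) (hB a b hab)
    rw [h1] at h2
    simp only [Finset.card_empty, pow_zero, Finset.card_singleton, pow_one, one_mul] at h2
    rw [← h2]
    refine measureReal_mono ?_
    rintro G ⟨⟨-, hG1⟩, hG2⟩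
    have hnot : b ∉ G.neighborSet a := by simpa using hG1
    simpa only [B, Set.mem_ofPred_eq, Set.sdiff_singleton_eq_self hnot] using hG2
  have hinter : (binomialRandom V p).real
      ({G | (G.neighborSet u).ncard ≤ k} ∩ {G | (G.neighborSet v).ncard ≤ k}) ≤
      (binomialRandom V p).real (B u v) * (binomialRandom V p).real (B v u) := by
    rw [← binomialRandom_real_inter_eq_mul p (S := S u v) (T := S v u) ?_ (hB u v huv)
      (hB v u huv.symm)]
    · refine measureReal_mono ?_
      rintro G ⟨h1, h2⟩
      exact ⟨(Set.ncard_le_ncard Set.sdiff_subset (Set.toFinite _)).trans h1,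
        (Set.ncard_le_ncard Set.sdiff_subset (Set.toFinite _)).trans h2⟩
    · rw [Finset.disjoint_left]
      intro e he he'
      simp only [S, Finset.mem_filter, Finset.mem_univ, true_and] at he he'
      exact he'.2 he.1
  have hp0 : (0 : ℝ) ≤ 1 - p := sub_nonneg.2 p.2.2
  calc _ ≤ (1 - p : ℝ) ^ 2 *
        ((binomialRandom V p).real (B u v) * (binomialRandom V p).real (B v u)) := by gcongr
    _ = ((1 - p : ℝ) * (binomialRandom V p).real (B u v)) *
        ((1 - p : ℝ) * (binomialRandom V p).real (B v u)) := by ring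
    _ ≤ _ := mul_le_mul (hstep u v huv) (hstep v u huv.symm) (by positivity) (by positivity)

/-- A lower bound for the probability that a given vertex has small degree. -/
theorem le_binomialRandom_real_ncard_neighborSet_le (k : ℕ) (v : V) :
    ((Fintype.card V - 1).choose k : ℝ) *
        ((p : ℝ) ^ k * (1 - p : ℝ) ^ (Fintype.card V - 1 - k)) ≤
      (binomialRandom V p).real {G | (G.neighborSet v).ncard ≤ k} := by
  classical
  let N : Finset V := Finset.univ.erase v
  have hN : N.card = Fintype.card V - 1 := Finset.card_erase_of_mem (Finset.mem_univ v)
  -- `E T` prescribes every pair at `v`, so these events are disjoint for distinct `T`.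
  let E : Finset V → Set (SimpleGraph V) := fun T =>
    {G | (∀ e ∈ T.image (fun w => s(v, w)), e ∈ G.edgeSet) ∧
      ∀ e ∈ (N \ T).image (fun w => s(v, w)), e ∉ G.edgeSet}
  have hinj : Function.Injective fun w => s(v, w) := fun a b h => Sym2.congr_right.1 h
  have hE : ∀ T ∈ N.powersetCard k, ∀ G ∈ E T, G.neighborSet v = T := by
    intro T hT G hG
    ext w
    constructor
    · intro hw
      by_contra hwT
      refine hG.2 s(v, w) (Finset.mem_image_of_mem _ ?_) hw
      rw [Finset.mem_sdiff]
      exact ⟨Finset.mem_erase.2 ⟨(G.ne_of_adj hw).symm, Finset.mem_univ _⟩, hwT⟩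
    · exact fun hw => hG.1 s(v, w) (Finset.mem_image_of_mem _ hw)
  have hprob : ∀ T ∈ N.powersetCard k, (binomialRandom V p).real (E T) =
      (p : ℝ) ^ k * (1 - p : ℝ) ^ (Fintype.card V - 1 - k) := by
    intro T hT
    rw [Finset.mem_powersetCard] at hT
    have hdiag : ∀ T' ⊆ N, ∀ e ∈ T'.image (fun w => s(v, w)), ¬ e.IsDiag := by
      intro T' hT' e he
      obtain ⟨w, hw, rfl⟩ := Finset.mem_image.1 he
      simpa using (Finset.ne_of_mem_erase (hT' hw)).symm
    rw [binomialRandom_real_cylinder p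
      ((Finset.disjoint_image hinj).2 Finset.disjoint_sdiff)
      (hdiag T hT.1) (hdiag _ Finset.sdiff_subset), Finset.card_image_of_injective _ hinj,
      Finset.card_image_of_injective _ hinj, Finset.card_sdiff_of_subset hT.1, hT.2, hN]
  calc _ = ∑ T ∈ N.powersetCard k, (binomialRandom V p).real (E T) := by
        rw [Finset.sum_congr rfl hprob, Finset.sum_const, Finset.card_powersetCard, hN,
          nsmul_eq_mul]
    _ = (binomialRandom V p).real (⋃ T ∈ N.powersetCard k, E T) := by
        refine (measureReal_biUnion_finset ?_ fun _ _ => measurableSet_of_finite _).symm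
        intro T hT T' hT' hne
        refine Set.disjoint_left.2 fun G hG hG' => hne ?_
        have := (hE T hT G hG).symm.trans (hE T' hT' G hG')
        exact_mod_cast this
    _ ≤ _ := by
        refine measureReal_mono ?_
        intro G hG
        simp only [Set.mem_iUnion] at hG
        obtain ⟨T, hT, hG⟩ := hG
        rw [Set.mem_ofPred_eq, hE T hT G hG, Set.ncard_coe_finset, (Finset.mem_powersetCard.1 hT).2]

/-- The union bound for the existence of an independent set with `m` elements. -/
theorem binomialRandom_real_exists_isIndepSet_le (m : ℕ) :
    (binomialRandom V p).real {G | ∃ s : Finset V, s.card = m ∧ G.IsIndepSet (s : Set V)} ≤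
      2 ^ Fintype.card V * (1 - p : ℝ) ^ m.choose 2 := by
  classical
  have hp0 : (0 : ℝ) ≤ 1 - p := sub_nonneg.2 p.2.2
  have hone : ∀ s : Finset V, (binomialRandom V p).real {G | G.IsIndepSet (s : Set V)} ≤
      (1 - p : ℝ) ^ s.card.choose 2 := by
    intro s
    have h := binomialRandom_real_cylinder p (S := ∅) (T := s.offDiag.image Sym2.mk.uncurry) (by simp)
      (by simp) (fun e he => by
        obtain ⟨⟨a, b⟩, hab, rfl⟩ := Finset.mem_image.1 he
        simpa using (Finset.mem_offDiag.1 hab).2.2)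
    rw [Sym2.card_image_offDiag, Finset.card_empty, pow_zero, one_mul] at h
    rw [← h]
    refine measureReal_mono ?_
    intro G hG
    refine ⟨by simp, fun e he => ?_⟩
    obtain ⟨⟨a, b⟩, hab, rfl⟩ := Finset.mem_image.1 he
    rw [Finset.mem_offDiag] at hab
    exact hG hab.1 hab.2.1 hab.2.2
  calc _ ≤ (binomialRandom V p).real
        (⋃ s ∈ (Finset.univ : Finset V).powersetCard m, {G | G.IsIndepSet (s : Set V)}) := by
        refine measureReal_mono ?_ (measure_ne_top _ _)
        rintro G ⟨s, hs, hG⟩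
        simp only [Set.mem_iUnion]
        exact ⟨s, Finset.mem_powersetCard.2 ⟨Finset.subset_univ _, hs⟩, hG⟩
    _ ≤ ∑ s ∈ (Finset.univ : Finset V).powersetCard m,
          (binomialRandom V p).real {G | G.IsIndepSet (s : Set V)} :=
        measureReal_biUnion_finset_le _ _
    _ ≤ ∑ s ∈ (Finset.univ : Finset V).powersetCard m, (1 - p : ℝ) ^ m.choose 2 := by
        refine Finset.sum_le_sum fun s hs => ?_
        rw [← (Finset.mem_powersetCard.1 hs).2]
        exact hone s
    _ = ((Fintype.card V).choose m : ℝ) * (1 - p : ℝ) ^ m.choose 2 := by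
        rw [Finset.sum_const, Finset.card_powersetCard, Finset.card_univ, nsmul_eq_mul]
    _ ≤ _ := by
        gcongr
        exact_mod_cast Nat.choose_le_two_pow _ _

/-- If the expected number of vertices of degree at most `k` is bounded below, then with
probability bounded away from zero there is such a vertex. -/
theorem binomialRandom_real_forall_lt_ncard_neighborSet_le (hp : (p : ℝ) ≤ 1 / 4) (k : ℕ) {x : ℝ}
    (hx : 0 ≤ x) (hle : x ≤ Fintype.card V * (((Fintype.card V - 1).choose k : ℝ) *
      ((p : ℝ) ^ k * (1 - p : ℝ) ^ (Fintype.card V - 1 - k)))) :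
    (binomialRandom V p).real {G | ∀ v, k < (G.neighborSet v).ncard} ≤ 1 - x / (1 + 2 * x) := by
  have h := measureReal_iInter_compl_le (binomialRandom V p)
    (A := fun v => {G : SimpleGraph V | (G.neighborSet v).ncard ≤ k})
    (fun _ => measurableSet_of_finite _) (fun u v huv => ?_) hx (hle.trans ?_)
  · refine le_trans (measureReal_mono ?_) h
    intro G hG
    simpa using hG
  · have h1 := binomialRandom_real_ncard_neighborSet_le_inter p k huv
    -- This turns the near-independence into correlation by a factor of at most two.
    have h2 : (1 / 2 : ℝ) ≤ (1 - p : ℝ) ^ 2 := by nlinarith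
    have h3 := mul_le_mul_of_nonneg_right h2 (measureReal_nonneg (μ := binomialRandom V p)
      (s := {G | (G.neighborSet u).ncard ≤ k} ∩ {G | (G.neighborSet v).ncard ≤ k}))
    linarith
  · rw [← nsmul_eq_mul, ← Finset.card_univ, ← Finset.sum_const]
    exact Finset.sum_le_sum fun v _ => le_binomialRandom_real_ncard_neighborSet_le p k v

end SimpleGraph

/-! ### Exponential estimates and the two ranges of `p`. -/

theorem Real.exp_neg_le_one_sub_pow {x : ℝ} (h0 : 0 ≤ x) (h1 : x ≤ 1 / 2) (n : ℕ) :
    Real.exp (-(n * x + 2 * n * x ^ 2)) ≤ (1 - x) ^ n := by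
  have hpos : 0 < 1 - x := by linarith
  have hlog : -(x + 2 * x ^ 2) ≤ Real.log (1 - x) := by
    refine le_trans ?_ (Real.one_sub_inv_le_log_of_pos hpos)
    rw [← one_div, le_sub_iff_add_le, ← le_sub_iff_add_le', div_le_iff₀ hpos]
    nlinarith [mul_nonneg (mul_nonneg h0 h0) (by linarith : 0 ≤ 1 - 2 * x)]
  rw [← Real.exp_log hpos, ← Real.exp_nat_mul]
  refine Real.exp_le_exp.2 ?_
  have := mul_le_mul_of_nonneg_left hlog (Nat.cast_nonneg (α := ℝ) n)
  linarith

theorem Real.one_sub_pow_le_exp_neg {x : ℝ} (h1 : x ≤ 1) (n : ℕ) :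
    (1 - x) ^ n ≤ Real.exp (-(n * x)) := by
  calc (1 - x) ^ n ≤ Real.exp (-x) ^ n := by
        have : 0 ≤ 1 - x := by linarith
        gcongr
        exact Real.one_sub_le_exp_neg x
    _ = Real.exp (-(n * x)) := by rw [← Real.exp_nat_mul]; ring_nf

namespace SimpleGraph

variable {V : Type*} [Fintype V]

theorem HasHamiltonGeneratedCycleSpace.two_le_ncard_neighborSet {G : SimpleGraph V}
    (hG : G.HasHamiltonGeneratedCycleSpace) (hc : ¬ G.IsAcyclic) (v : V) :
    2 ≤ (G.neighborSet v).ncard := by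
  obtain ⟨H, hH⟩ := hG.exists_isHamiltonCircuitOf hc
  rw [← hH.2.2 v]
  exact Set.ncard_le_ncard (fun _ h => hH.1 h) (Set.toFinite _)

theorem HasHamiltonGeneratedCycleSpace.two_lt_ncard_neighborSet_or_exists_isIndepSet
    {G : SimpleGraph V} (hG : G.HasHamiltonGeneratedCycleSpace) (hc : ¬ G.IsAcyclic) {m : ℕ}
    (hm : Fintype.card V = 2 * m + 1) :
    (∀ v, 2 < (G.neighborSet v).ncard) ∨
      ∃ s : Finset V, s.card = m ∧ G.IsIndepSet (s : Set V) := by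
  by_contra! h
  obtain ⟨⟨v, hv⟩, hno⟩ := h
  obtain ⟨s, hs, hs'⟩ := exists_isIndepSet_of_colorable_two_induce_compl
    (hG.colorable_two_induce_compl hc ⟨m, hm⟩ hv) hm
  exact hno s hs hs'

end SimpleGraph

open SimpleGraph

/-- Below the threshold for isolated vertices, a Hamilton generated cycle space is unlikely. -/
theorem binomialRandom_real_hasHamiltonGeneratedCycleSpace_le_of_le_log_div {n : ℕ}
    (p : unitInterval) (hn : 32 * Real.log n ^ 2 ≤ n) (hlog : 1 ≤ Real.log n)
    (hp : (p : ℝ) ≤ Real.log n / n) {x : ℝ} (hx : 0 ≤ x) (hx1 : x ≤ Real.exp (-1)) :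
    (binomialRandom (Fin n) p).real
      {G | ¬ G.IsAcyclic ∧ G.HasHamiltonGeneratedCycleSpace} ≤ 1 - x / (1 + 2 * x) := by
  have hn0 : (0 : ℝ) < n := by nlinarith
  have hp0 : (0 : ℝ) ≤ p := p.2.1
  have hnp : n * (p : ℝ) ≤ Real.log n := by rwa [le_div_iff₀ hn0, mul_comm] at hp
  -- The second-order error in the exponent costs at most a factor `exp (-1)`.
  have hnp2 : 2 * n * (p : ℝ) ^ 2 ≤ 1 := by
    have h1 : (n * (p : ℝ)) ^ 2 ≤ Real.log n ^ 2 := by gcongr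
    have h2 : n * (2 * n * (p : ℝ) ^ 2) ≤ n * 1 := by nlinarith
    exact le_of_mul_le_mul_left h2 hn0
  have hp4 : (p : ℝ) ≤ 1 / 4 := by
    refine hp.trans ?_
    rw [div_le_iff₀ hn0]
    nlinarith
  refine le_trans (measureReal_mono ?_ (measure_ne_top _ _))
    (binomialRandom_real_forall_lt_ncard_neighborSet_le (V := Fin n) p hp4 0 hx ?_)
  · rintro G ⟨hc, hG⟩ v
    exact lt_of_lt_of_le two_pos (hG.two_le_ncard_neighborSet hc v)
  · simp only [Fintype.card_fin, Nat.choose_zero_right, Nat.cast_one, pow_zero, one_mul,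
      Nat.sub_zero]
    calc x ≤ Real.exp (-1) := hx1
      _ ≤ Real.exp (Real.log n + -(n * (p : ℝ) + 2 * n * (p : ℝ) ^ 2)) :=
          Real.exp_le_exp.2 (by linarith)
      _ = n * Real.exp (-(n * (p : ℝ) + 2 * n * (p : ℝ) ^ 2)) := by
          rw [Real.exp_add, Real.exp_log hn0]
      _ ≤ n * (1 - p : ℝ) ^ n := by
          gcongr
          exact Real.exp_neg_le_one_sub_pow hp0 (by linarith) n
      _ ≤ n * (1 - p : ℝ) ^ (n - 1) := by
          gcongr ?_ * ?_
          exact pow_le_pow_of_le_one (by linarith) (by linarith) (Nat.sub_le _ _)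

/-- Between the threshold for isolated vertices and the threshold for vertices of degree two, a
Hamilton generated cycle space is unlikely if the number of vertices is odd. -/
theorem binomialRandom_real_hasHamiltonGeneratedCycleSpace_le_of_log_div_le {n m : ℕ}
    (hm : n = 2 * m + 1) (p : unitInterval) {c : ℝ} (hn : 32 * Real.log n ^ 2 ≤ n)
    (hlog : 32 ≤ Real.log n) (hclog : c ≤ Real.log n)
    (hp : Real.log n / n ≤ p)
    (hp' : (p : ℝ) ≤ (Real.log n + 2 * Real.log (Real.log n) + c) / n) {x : ℝ} (hx : 0 ≤ x)
    (hx1 : x ≤ Real.exp (-(c + 1)) / 4) :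
    (binomialRandom (Fin n) p).real
      {G | ¬ G.IsAcyclic ∧ G.HasHamiltonGeneratedCycleSpace} ≤
        1 - x / (1 + 2 * x) + Real.exp (-n) := by
  have hn0 : (0 : ℝ) < n := by nlinarith
  have hn32 : (32 : ℝ) ≤ n := by nlinarith
  have hp0 : (0 : ℝ) ≤ p := p.2.1
  have hloglog : Real.log (Real.log n) ≤ Real.log n := Real.log_le_self (by linarith)
  have hnp : n * (p : ℝ) ≤ Real.log n + 2 * Real.log (Real.log n) + c := by
    rwa [le_div_iff₀ hn0, mul_comm] at hp'
  have hnp4 : n * (p : ℝ) ≤ 4 * Real.log n := by linarith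
  have hlognp : Real.log n ≤ n * (p : ℝ) := by rwa [div_le_iff₀ hn0, mul_comm] at hp
  have hnp2 : 2 * n * (p : ℝ) ^ 2 ≤ 1 := by
    have h1 : (n * (p : ℝ)) ^ 2 ≤ (4 * Real.log n) ^ 2 := by gcongr
    have h2 : n * (2 * n * (p : ℝ) ^ 2) ≤ n * 1 := by nlinarith
    exact le_of_mul_le_mul_left h2 hn0
  have hp4 : (p : ℝ) ≤ 1 / 4 := by nlinarith
  have hsub : {G : SimpleGraph (Fin n) | ¬ G.IsAcyclic ∧ G.HasHamiltonGeneratedCycleSpace} ⊆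
      {G | ∀ v, 2 < (G.neighborSet v).ncard} ∪
        {G | ∃ s : Finset (Fin n), s.card = m ∧ G.IsIndepSet (s : Set (Fin n))} :=
    fun G hG => hG.2.two_lt_ncard_neighborSet_or_exists_isIndepSet hG.1 (by simpa using hm)
  refine (measureReal_mono hsub (measure_ne_top _ _)).trans ((measureReal_union_le _ _).trans
    (add_le_add ?_ ?_))
  · refine binomialRandom_real_forall_lt_ncard_neighborSet_le (V := Fin n) p hp4 2 hx ?_
    have hn1 : 1 ≤ n := by omega
    have hchoose : (n : ℝ) ^ 2 / 4 ≤ ((n - 1).choose 2 : ℝ) := by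
      rw [Nat.cast_choose_two, Nat.cast_sub hn1]
      push_cast
      nlinarith
    have hlogpos : 0 < Real.log n := by linarith
    rw [Fintype.card_fin]
    calc x ≤ Real.exp (-(c + 1)) / 4 := hx1
      _ ≤ Real.exp (Real.log n + 2 * Real.log (Real.log n) +
            -(n * (p : ℝ) + 2 * n * (p : ℝ) ^ 2)) / 4 := by
          gcongr
          linarith
      -- The term `2 log log n` contributes `log n ^ 2`, which `(n * p) ^ 2` then dominates: this is
      -- the gain from allowing degree two.
      _ = n * (Real.log n ^ 2 / 4 * Real.exp (-(n * (p : ℝ) + 2 * n * (p : ℝ) ^ 2))) := by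
          rw [Real.exp_add, Real.exp_add, Real.exp_log hn0, two_mul (Real.log (Real.log n)),
            Real.exp_add, Real.exp_log hlogpos]
          ring
      _ ≤ n * ((n * (p : ℝ)) ^ 2 / 4 * (1 - p : ℝ) ^ (n - 1 - 2)) := by
          gcongr
          refine (Real.exp_neg_le_one_sub_pow hp0 (by linarith) n).trans ?_
          exact pow_le_pow_of_le_one (by linarith) (by linarith) (by omega)
      _ = n * ((n : ℝ) ^ 2 / 4 * ((p : ℝ) ^ 2 * (1 - p : ℝ) ^ (n - 1 - 2))) := by ring
      _ ≤ _ := by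
          have : (0 : ℝ) ≤ 1 - p := by linarith
          gcongr
  · refine (binomialRandom_real_exists_isIndepSet_le (V := Fin n) p m).trans ?_
    rw [Fintype.card_fin]
    have hchoose : (n : ℝ) ^ 2 / 16 ≤ (m.choose 2 : ℝ) := by
      have hm' : (m : ℝ) = (n - 1) / 2 := by rw [hm]; push_cast; ring
      rw [Nat.cast_choose_two, hm']
      nlinarith
    -- Here `32 ≤ log n ≤ n * p` is needed, so that the exponent beats the `2 ^ n` of the union
    -- bound.
    have hexp : 2 * (n : ℝ) ≤ m.choose 2 * (p : ℝ) := by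
      calc 2 * (n : ℝ) ≤ n * (n * (p : ℝ)) / 16 := by nlinarith
        _ = (n : ℝ) ^ 2 / 16 * p := by ring
        _ ≤ _ := by gcongr
    calc (2 : ℝ) ^ n * (1 - p : ℝ) ^ m.choose 2
        ≤ Real.exp 1 ^ n * Real.exp (-(m.choose 2 * (p : ℝ))) := by
          have : (0 : ℝ) ≤ 1 - p := by linarith
          gcongr
          · linarith [Real.add_one_le_exp (1 : ℝ)]
          · exact Real.one_sub_pow_le_exp_neg p.2.2 _
      _ = Real.exp (n - m.choose 2 * (p : ℝ)) := by
          rw [← Real.exp_nat_mul, ← Real.exp_add]; ring_nf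
      _ ≤ Real.exp (-n) := Real.exp_le_exp.2 (by linarith)

theorem mainTheorem2 (p : ℕ → unitInterval)
    (hp : Tendsto
      (fun n : ℕ => SimpleGraph.binomialRandom (Fin n) (p n)
        {G : SimpleGraph (Fin n) |
          (¬ G.IsAcyclic ∧ ¬ G.IsCircuitGraph) ∧ G.HasHamiltonGeneratedCycleSpace})
      (atTop ⊓ 𝓟 {n : ℕ | Odd n}) (𝓝 1))
    (c : ℝ) (hc : 0 < c) :
    ∀ᶠ n : ℕ in atTop, Odd n →
      (Real.log (n : ℝ) + 2 * Real.log (Real.log (n : ℝ)) + c) / (n : ℝ) < (p n : ℝ) := by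
  set x : ℝ := Real.exp (-(c + 1)) / 4 with hx
  have hx0 : 0 < x := by positivity
  set δ : ℝ := x / (1 + 2 * x) with hδ
  have hδ0 : 0 < δ := by positivity
  have hp' := (ENNReal.tendsto_toReal ENNReal.one_ne_top).comp hp
  rw [ENNReal.toReal_one] at hp'
  have hlarge := hp'.eventually (lt_mem_nhds (show 1 - δ / 2 < 1 by linarith))
  rw [eventually_inf_principal] at hlarge
  have hlog : Tendsto (fun n : ℕ => Real.log n) atTop atTop :=
    Real.tendsto_log_atTop.comp tendsto_natCast_atTop_atTop
  have hsq : ∀ᶠ n : ℕ in atTop, 32 * Real.log n ^ 2 ≤ n := by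
    have h := tendsto_natCast_atTop_atTop (R := ℝ) |>.eventually
      ((Real.isLittleO_pow_log_id_atTop (n := 2)).bound (show (0 : ℝ) < 1 / 32 by norm_num))
    filter_upwards [h] with n hn
    rw [Real.norm_of_nonneg (by positivity), id, Real.norm_of_nonneg (by positivity)] at hn
    linarith
  have hexp : ∀ᶠ n : ℕ in atTop, Real.exp (-n) < δ / 2 :=
    (Real.tendsto_exp_neg_atTop_nhds_zero.comp tendsto_natCast_atTop_atTop).eventually
      (gt_mem_nhds (by positivity))
  filter_upwards [hlarge, hsq, hexp, hlog.eventually_ge_atTop 32, hlog.eventually_ge_atTop c]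
    with n hn hn2 hn3 hn4 hn5 hodd
  by_contra! hle
  have h1 : 1 - δ / 2 < (SimpleGraph.binomialRandom (Fin n) (p n)).real
      {G | ¬ G.IsAcyclic ∧ G.HasHamiltonGeneratedCycleSpace} :=
    (hn hodd).trans_le (measureReal_mono (fun G hG => ⟨hG.1.1, hG.2⟩) (measure_ne_top _ _))
  have h2 := Real.exp_pos (-(n : ℝ))
  -- For very small `p` the independent set bound fails, so isolated vertices take over there. Both
  -- ranges contradict `h1`, since `exp (-n) < δ / 2`.
  rcases le_total ((p n : ℝ)) (Real.log n / n) with h | h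
  · have hx1 : x ≤ Real.exp (-1) := by
      have h3 : Real.exp (-(c + 1)) ≤ Real.exp (-1) := Real.exp_le_exp.2 (by linarith)
      have h4 := Real.exp_pos (-(c + 1))
      rw [hx]
      linarith
    have := binomialRandom_real_hasHamiltonGeneratedCycleSpace_le_of_le_log_div (p n) hn2
      (by linarith) h hx0.le hx1
    linarith
  · obtain ⟨m, hm⟩ := hodd
    have := binomialRandom_real_hasHamiltonGeneratedCycleSpace_le_of_log_div_le hm (p n) hn2 hn4
      hn5 h hle hx0.le le_rfl
    linarith
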